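/- Let $N\ge 2$, $\lambda,\beta>0$, $L>0$, $\ell\ge 0$, $\sigma\in\mathbb R\setminus\{0\}$. Consider $N$ particles on a ring of length $L$ with positions $x_1(t),\dots,x_N(t)\in\mathbb R$ and spacings $\Delta x_n(t)=x_{n+1}(t)-x_n(t)$ for $n<N$, $\Delta x_N(t)=L+x_1(t)-x_N(t)$, evolving for $t\ge0$ by $$\dot x_n(t)=\lambda(\Delta x_n(t)-\ell)+\xi_n(t),\qquad d\xi_n(t)=-\beta\,\xi_n(t)\,dt+\sigma\,dW_n(t),\qquad n=1,\dots,N,$$ where $W_1,\dots,W_N$ are independent Wiener processes, the noises $\xi_n$ have continuous paths, and the initial noises $\xi_n(0)$ and initial spacings $\Delta x_n(0)$ are square integrable (the latter holds automatically if $x_1(0)\le\dots\le x_N(0)\le L+x_1(0)$). Let $y_n(t)=\Delta x_n(t)-L/N$ be the spacing deviations, with particle indices taken modulo $N$. Then the $y_n(t)$, $t\ge 0$, are square integrable, and for all $j\in\mathbb Z/N\mathbb Z$ and $\tau\ge 0$ the limit $$\mathrm{cov}_j(\tau)=\lim_{t\to\infty}\mathrm{cov}\big(y_n(t),\,y_{n+j}(t+\tau)\big)$$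 exists and is the same for every particle $n$; moreover $\mathrm{cov}_0(0)>0$. The stationary correlations $$\mathrm{cor}_j(\tau)=\frac{\mathrm{cov}_j(\tau)}{\mathrm{cov}_0(0)},\qquad j\in\mathbb Z/N\mathbb Z,\ \tau\ge0,$$ (in particular the correlation $\mathrm{cor}_j(0)$ and the autocorrelation $\mathrm{cor}_0(\tau)$) do not depend on the noise amplitude $\sigma$: there is a function of $(j,\tau)$, determined by $N,\lambda,\beta$ alone, that equals $\mathrm{cor}_j(\tau)$ for every $\sigma\neq0$, all $L$, $\ell$, and every solution of the model as above. -/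

import Mathlib

open MeasureTheory ProbabilityTheory Filter Topology Set
open scoped NNReal

noncomputable section

/-- Spacings of `N` particles at positions `x` on a ring of length `L`: the distance from particle
`n` to particle `n + 1`. The particles are indexed by `Fin N`, whose addition is cyclic, so the
successor of the last particle is the first one, and `L` is added in that case only. -/
def ringSpacing {N : ℕ} [NeZero N] (L : ℝ) (x : Fin N → ℝ) (n : Fin N) : ℝ :=
  x (n + 1) - x n + if (n : ℕ) + 1 = N then L else 0

/-- The spacing deviation `y n t`: the difference between the spacing of particle `n` at time `t`
and the spacing `L / N` of the homogeneous solution. -/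
def spacingDeviation {N : ℕ} [NeZero N] {Ω : Type*} (L : ℝ) (x : Fin N → ℝ → Ω → ℝ)
    (n : Fin N) (t : ℝ) (ω : Ω) : ℝ :=
  ringSpacing L (fun m => x m t ω) n - L / N

/-- The stochastic following model on the probability space `(Ω, P)`. The positions `x n t` and
the noises `ξ n t` are only constrained at times `t ≥ 0`. As the noise in the equation
`dξ = -β ξ dt + σ dW` is additive, that equation means exactly its pathwise integrated form. -/
structure IsFollowingModel {N : ℕ} [NeZero N] {Ω : Type*} [MeasurableSpace Ω]
    (lam ell β σ L : ℝ) (P : Measure Ω) (W : Fin N → ℝ≥0 → Ω → ℝ)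
    (ξ x : Fin N → ℝ → Ω → ℝ) : Prop where
  /-- Each driving process is a Wiener process. -/
  wiener : ∀ n, IsBrownianReal (W n) P
  /-- The Wiener processes are independent. -/
  indep : iIndepFun (fun n ω t => W n t ω) P
  /-- The noises are random variables at each time. -/
  noise_aemeasurable : ∀ n t, 0 ≤ t → AEMeasurable (ξ n t) P
  /-- The positions are random variables at each time. -/
  position_aemeasurable : ∀ n t, 0 ≤ t → AEMeasurable (x n t) P
  /-- The noises have continuous paths almost surely. -/
  noise_continuous : ∀ᵐ ω ∂P, ∀ n, ContinuousOn (fun t => ξ n t ω) (Ici 0)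
  /-- The noises solve the Ornstein-Uhlenbeck equation. -/
  noise_eq : ∀ᵐ ω ∂P, ∀ n, ∀ t : ℝ≥0,
    ξ n t ω = ξ n 0 ω - β * (∫ s in (0 : ℝ)..t, ξ n s ω) + σ * W n t ω
  /-- The speed of a particle is the optimal velocity at its spacing plus its noise. -/
  position_deriv : ∀ᵐ ω ∂P, ∀ n, ∀ t, 0 ≤ t →
    HasDerivWithinAt (fun s => x n s ω)
      (lam * (ringSpacing L (fun m => x m t ω) n - ell) + ξ n t ω) (Ici 0) t

/-- `c j τ` is, for all `j` and all time lags `τ ≥ 0`, the asymptotic (stationary) covariance of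
the process `y`: for every particle `n`, the covariance of `y n t` and `y (n + j) (t + τ)`
(particle indices are cyclic) tends to `c j τ` as `t → ∞`. -/
def IsAsymptoticCovariance {N : ℕ} {Ω : Type*} [MeasurableSpace Ω] (P : Measure Ω)
    (y : Fin N → ℝ → Ω → ℝ) (c : Fin N → ℝ → ℝ) : Prop :=
  ∀ (n j : Fin N) (τ : ℝ), 0 ≤ τ →
    Tendsto (fun t : ℝ => cov[y n t, y (n + j) (t + τ); P]) atTop (𝓝 (c j τ))

end

/-! ### The linear system for deviations and integrated noises, and its flow. -/

noncomputable section

/-! Because the noise is additive, no stochastic calculus is needed. With `X` the integrated noise,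
the Ornstein-Uhlenbeck equation reads `ξ = ξ(0) + σ W - β X`, so almost every path of `(y, X)`
solves a linear ODE with constant coefficients and continuous forcing `ξ(0) + σ W`. Variation of
constants (`deviation_path_eq`) writes `y n t` as a transient, linear in the initial deviations and
noises, plus `σ` times the sum over `m` of `∫ g'(t - s) W m s ds` over `[0, t]`. Here `g` is
`noiseKernel` and `g 0 = 0`, so each integral is the Wiener integral of `g(t - s)` after integration
by parts.

Fubini and `cov(W s, W r) = min s r` give the covariance of the stochastic parts as `σ²` times the
sum over `m` of the integrals of `g_{n,m}(v) g_{n+j,m}(v + τ)` over `[0, t]`. Zero-sum deviations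
decay exponentially (`followingFlow_decay`, an energy estimate resting on a Poincaré inequality on
the ring), so these integrals converge as `t → ∞` and the transient coefficients vanish; cross
covariances need only be bounded (`tendsto_covariance_add_transient`). Cyclic symmetry removes the
dependence on `n`.

The limit is therefore `σ²` times a function of `N`, `lam`, `β`, `j`, `τ`. It is positive at `j =
0`, `τ = 0`, since `g_{0,0}` has slope `-1` at `0`, and `σ²` cancels in the quotient. -/

/-- Generator of the linear system satisfied by the spacing deviations and the integrated noises. -/
def followingGenerator (N : ℕ) [NeZero N] (lam β : ℝ) :
    ((Fin N → ℝ) × (Fin N → ℝ)) →L[ℝ] ((Fin N → ℝ) × (Fin N → ℝ)) :=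
  LinearMap.toContinuousLinearMap
    { toFun := fun z =>
        (fun k => lam * (z.1 (k + 1) - z.1 k) - β * (z.2 (k + 1) - z.2 k), fun k => -β * z.2 k)
      map_add' := fun z w => by
        ext k <;> simp <;> ring
      map_smul' := fun r z => by
        ext k <;> simp <;> ring }

lemma followingGenerator_apply {N : ℕ} [NeZero N] (lam β : ℝ) (z : (Fin N → ℝ) × (Fin N → ℝ)) :
    followingGenerator N lam β z =
      (fun k => lam * (z.1 (k + 1) - z.1 k) - β * (z.2 (k + 1) - z.2 k), fun k => -β * z.2 k) :=
  rfl

/-- The flow generated by `followingGenerator`. -/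
def followingFlow (N : ℕ) [NeZero N] (lam β t : ℝ) :
    ((Fin N → ℝ) × (Fin N → ℝ)) →L[ℝ] ((Fin N → ℝ) × (Fin N → ℝ)) :=
  NormedSpace.exp (t • followingGenerator N lam β)

/-- Cyclic shift of the particle indices. -/
def ringShift (N : ℕ) [NeZero N] (j : Fin N) :
    ((Fin N → ℝ) × (Fin N → ℝ)) →L[ℝ] ((Fin N → ℝ) × (Fin N → ℝ)) :=
  LinearMap.toContinuousLinearMap
    { toFun := fun z => (fun k => z.1 (k + j), fun k => z.2 (k + j))
      map_add' := fun _ _ => rfl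
      map_smul' := fun _ _ => rfl }

lemma ringShift_apply {N : ℕ} [NeZero N] (j : Fin N) (z : (Fin N → ℝ) × (Fin N → ℝ)) :
    ringShift N j z = (fun k => z.1 (k + j), fun k => z.2 (k + j)) := rfl

section Flow

variable {N : ℕ} [NeZero N] (lam β : ℝ)

lemma followingFlow_zero (z : (Fin N → ℝ) × (Fin N → ℝ)) : followingFlow N lam β 0 z = z := by
  simp [followingFlow]

lemma hasDerivAt_followingFlow_op (t : ℝ) :
    HasDerivAt (fun t => followingFlow N lam β t)
      (followingFlow N lam β t * followingGenerator N lam β) t :=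
  hasDerivAt_exp_smul_const (followingGenerator N lam β) t

lemma followingFlow_generator (t : ℝ) (z : (Fin N → ℝ) × (Fin N → ℝ)) :
    followingFlow N lam β t (followingGenerator N lam β z) =
      followingGenerator N lam β (followingFlow N lam β t z) := by
  have h : Commute (followingGenerator N lam β) (followingFlow N lam β t) :=
    ((Commute.refl _).smul_right t).exp_right
  exact (DFunLike.congr_fun h.eq z).symm

/-- The particles are identical, so the generator commutes with the shift, and hence so does its
exponential. -/
lemma followingFlow_shift (j : Fin N) (t : ℝ) (z : (Fin N → ℝ) × (Fin N → ℝ)) :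
    followingFlow N lam β t (ringShift N j z) = ringShift N j (followingFlow N lam β t z) := by
  have h0 : Commute (ringShift N j) (followingGenerator N lam β) := by
    ext z k
    all_goals simp [ringShift_apply, followingGenerator_apply, add_right_comm]
  have h : Commute (ringShift N j) (followingFlow N lam β t) := (h0.smul_right t).exp_right
  exact (DFunLike.congr_fun h.eq z).symm

lemma hasDerivAt_followingFlow (z : (Fin N → ℝ) × (Fin N → ℝ)) (t : ℝ) :
    HasDerivAt (fun t => followingFlow N lam β t z)
      (followingGenerator N lam β (followingFlow N lam β t z)) t := by
  have := (hasDerivAt_followingFlow_op (N := N) lam β t).clm_apply (hasDerivAt_const t z)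
  simpa [followingFlow_generator] using this

lemma hasDerivAt_followingFlow_fst (z : (Fin N → ℝ) × (Fin N → ℝ)) (n : Fin N) (t : ℝ) :
    HasDerivAt (fun t => (followingFlow N lam β t z).1 n)
      ((followingFlow N lam β t (followingGenerator N lam β z)).1 n) t := by
  rw [followingFlow_generator]
  exact hasDerivAt_pi.1 (hasDerivAt_followingFlow lam β z t).fst n

lemma hasDerivAt_followingFlow_snd (z : (Fin N → ℝ) × (Fin N → ℝ)) (n : Fin N) (t : ℝ) :
    HasDerivAt (fun t => (followingFlow N lam β t z).2 n)
      (-β * (followingFlow N lam β t z).2 n) t :=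
  hasDerivAt_pi.1 (hasDerivAt_followingFlow lam β z t).snd n

lemma continuous_followingFlow_fst (z : (Fin N → ℝ) × (Fin N → ℝ)) (n : Fin N) :
    Continuous (fun t => (followingFlow N lam β t z).1 n) :=
  continuous_iff_continuousAt.2 fun t => (hasDerivAt_followingFlow_fst lam β z n t).continuousAt

lemma sum_shift_eq (f : Fin N → ℝ) : ∑ k, f (k + 1) = ∑ k, f k :=
  Equiv.sum_comp (Equiv.addRight (1 : Fin N)) f

/-- Both coupling terms are differences along the ring and sum to zero. The zero-sum subspace, on
which the Poincaré inequality holds, is thus invariant. -/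
lemma sum_followingFlow_fst (z : (Fin N → ℝ) × (Fin N → ℝ)) (t : ℝ) :
    ∑ k, (followingFlow N lam β t z).1 k = ∑ k, z.1 k := by
  have hd : ∀ t, HasDerivAt (fun t => ∑ k, (followingFlow N lam β t z).1 k) 0 t := by
    intro t
    refine (HasDerivAt.fun_sum (u := Finset.univ)
      fun k _ => hasDerivAt_followingFlow_fst lam β z k t).congr_deriv ?_
    simp only [followingFlow_generator]
    simp only [followingGenerator_apply, Finset.sum_sub_distrib, ← Finset.mul_sum]
    rw [sum_shift_eq fun k => (followingFlow N lam β t z).1 k,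
      sum_shift_eq fun k => (followingFlow N lam β t z).2 k]
    ring
  have := is_const_of_deriv_eq_zero (fun t => (hd t).differentiableAt) (fun t => (hd t).deriv) t 0
  simpa [followingFlow_zero] using this

end Flow

/-! ### Exponential decay by an energy estimate. -/

/-- Along the ring, a coordinate differs from a given one by at most the total variation. -/
lemma abs_sub_le_sum_ring {N : ℕ} [NeZero N] (v : Fin N → ℝ) (i j : Fin N) :
    |v i - v j| ≤ ∑ k, |v (k + 1) - v k| := by
  have mono : ∀ (n : ℕ) (f : ℕ → ℝ) (a b : ℕ), a ≤ b → b ≤ n →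
      |f b - f a| ≤ ∑ k ∈ Finset.range n, |f (k + 1) - f k| := by
    intro n f a b hab hbn
    rw [← Finset.sum_Ico_sub f hab]
    refine (Finset.abs_sum_le_sum_abs _ _).trans ?_
    refine Finset.sum_le_sum_of_subset_of_nonneg ?_ fun _ _ _ => abs_nonneg _
    intro k hk
    simp only [Finset.mem_Ico, Finset.mem_range] at hk ⊢
    omega
  have key : ∀ a b : Fin N, a ≤ b → |v b - v a| ≤ ∑ k, |v (k + 1) - v k| := by
    intro a b hab
    -- `Fin.ofNat` extends `v` periodically to `ℕ`, so the `N` increments include the closing edge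
    -- from the last particle to the first.
    have h := mono N (fun k => v (Fin.ofNat N k)) a b hab b.2.le
    simp only [Fin.ofNat_val_eq_self] at h
    refine h.trans (le_of_eq ?_)
    rw [← Fin.sum_univ_eq_sum_range (fun k => |v (Fin.ofNat N (k + 1)) - v (Fin.ofNat N k)|) N]
    refine Finset.sum_congr rfl fun k _ => ?_
    have : Fin.ofNat N ((k : ℕ) + 1) = k + 1 := by
      ext; simp [Fin.val_add]
    rw [this, Fin.ofNat_val_eq_self]
  rcases le_total i j with h | h
  · rw [abs_sub_comm]; exact key i j h
  · exact key j i h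

/-- Poincaré inequality on the ring. -/
lemma sum_sq_le_ring {N : ℕ} [NeZero N] (v : Fin N → ℝ) (hv : ∑ k, v k = 0) :
    ∑ k, v k ^ 2 ≤ (N : ℝ) ^ 2 * ∑ k, (v (k + 1) - v k) ^ 2 := by
  have hN : (0 : ℝ) < N := by exact_mod_cast Nat.pos_of_ne_zero (NeZero.ne N)
  set T := ∑ k, |v (k + 1) - v k| with hT
  have h1 : ∀ i, |v i| ≤ T := by
    intro i
    -- As `v` has mean zero, `v i` is the average of its differences to the other coordinates.
    have e : (N : ℝ) * v i = ∑ j, (v i - v j) := by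
      simp [Finset.sum_sub_distrib, hv]
    have : (N : ℝ) * |v i| ≤ N * T := by
      rw [← abs_of_pos hN, ← abs_mul, abs_of_pos hN, e]
      refine (Finset.abs_sum_le_sum_abs _ _).trans ?_
      refine (Finset.sum_le_sum fun j _ => abs_sub_le_sum_ring v i j).trans ?_
      simp [hT]
    exact le_of_mul_le_mul_left this hN
  have h2 : T ^ 2 ≤ N * ∑ k, (v (k + 1) - v k) ^ 2 := by
    have := sq_sum_le_card_mul_sum_sq (s := (Finset.univ : Finset (Fin N)))
      (f := fun k => |v (k + 1) - v k|)
    simpa [sq_abs] using this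
  calc ∑ k, v k ^ 2 ≤ ∑ _k : Fin N, T ^ 2 :=
        Finset.sum_le_sum fun k _ => sq_le_sq' (abs_le.1 (h1 k)).1 (abs_le.1 (h1 k)).2
    _ = N * T ^ 2 := by simp
    _ ≤ N * (N * ∑ k, (v (k + 1) - v k) ^ 2) := by gcongr
    _ = _ := by ring

/-- Energy dissipation of the linear system on the sum-zero deviations. -/
lemma energy_dissipation {N : ℕ} [NeZero N] {lam β : ℝ} (hlam : 0 < lam) (hβ : 0 < β) :
    ∃ M > 0, ∃ κ > 0, ∀ y w : Fin N → ℝ, ∑ k, y k = 0 →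
      ∑ k, (2 * y k * (lam * (y (k + 1) - y k) - β * (w (k + 1) - w k))
        + M * (2 * w k * (-β * w k))) ≤ -(2 * κ) * ∑ k, (y k ^ 2 + M * w k ^ 2) := by
  have hN : (0 : ℝ) < N := by exact_mod_cast Nat.pos_of_ne_zero (NeZero.ne N)
  set c : ℝ := lam / N ^ 2 with hc
  have hcpos : 0 < c := by positivity
  -- `c` is the dissipation left by Poincaré. `M * c = 8 * β` is the equality case of Young's
  -- inequality in `hcross`: half of each dissipation absorbs the coupling, and `c / 2` for `y` and
  -- `β` for the weighted `w` remain, whence `2 * κ`.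
  refine ⟨8 * β / c, by positivity, min (c / 4) (β / 2), by positivity, fun y w hy => ?_⟩
  have hP : c * ∑ k, y k ^ 2 ≤ lam * ∑ k, (y (k + 1) - y k) ^ 2 := by
    have := mul_le_mul_of_nonneg_left (sum_sq_le_ring y hy) hcpos.le
    refine this.trans (le_of_eq ?_)
    rw [hc]; field_simp
  set M := 8 * β / c with hM
  have hMc : M * c = 8 * β := by rw [hM]; field_simp
  have hMpos : 0 < M := by positivity
  have hdrift : ∑ k, 2 * y k * (y (k + 1) - y k) = - ∑ k, (y (k + 1) - y k) ^ 2 := by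
    have e := sum_shift_eq (fun k => y k ^ 2)
    rw [← sub_eq_zero, ← Finset.sum_sub_distrib] at e
    rw [← sub_eq_zero, sub_neg_eq_add, ← Finset.sum_add_distrib, ← e]
    exact Finset.sum_congr rfl fun k _ => by ring
  have hcross : ∀ k, -(2 * β) * y k * (w (k + 1) - w k) ≤
      c / 2 * y k ^ 2 + β * M / 2 * (w (k + 1) ^ 2 + w k ^ 2) := by
    intro k
    have hb : β = M * c / 8 := by rw [hMc]; ring
    have e : ∀ a b : ℝ, -(2 * β) * a * b ≤ c / 4 * a ^ 2 + β * M / 2 * b ^ 2 := by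
      intro a b
      have h : 0 ≤ c / 4 * (a + M / 2 * b) ^ 2 := by positivity
      have h2 : c / 4 * (a + M / 2 * b) ^ 2 =
        c / 4 * a ^ 2 + (M * c / 8) * 2 * a * b + (M * c / 8) * M / 2 * b ^ 2 := by ring
      rw [← hb] at h2
      linarith
    have h1 := e (y k) (w (k + 1))
    have h2 := e (y k) (-w k)
    have : (-w k) ^ 2 = w k ^ 2 := by ring
    rw [this] at h2
    linarith
  have hsum := Finset.sum_le_sum fun k (_ : k ∈ Finset.univ) => hcross k
  rw [Finset.sum_add_distrib, ← Finset.mul_sum, ← Finset.mul_sum, Finset.sum_add_distrib,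
    sum_shift_eq (fun k => w k ^ 2)] at hsum
  have expand : ∑ k, (2 * y k * (lam * (y (k + 1) - y k) - β * (w (k + 1) - w k))
        + M * (2 * w k * (-β * w k))) = lam * (∑ k, 2 * y k * (y (k + 1) - y k))
        + ∑ k, -(2 * β) * y k * (w (k + 1) - w k) - 2 * β * M * ∑ k, w k ^ 2 := by
    rw [Finset.mul_sum, Finset.mul_sum, ← Finset.sum_add_distrib, ← Finset.sum_sub_distrib]
    exact Finset.sum_congr rfl fun k _ => by ring
  rw [expand, hdrift, Finset.sum_add_distrib, ← Finset.mul_sum]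
  have hY : 0 ≤ ∑ k, y k ^ 2 := Finset.sum_nonneg fun _ _ => sq_nonneg _
  have hW : 0 ≤ M * ∑ k, w k ^ 2 :=
    mul_nonneg hMpos.le (Finset.sum_nonneg fun _ _ => sq_nonneg _)
  have k1 := mul_le_mul_of_nonneg_right (min_le_left (c / 4) (β / 2)) hY
  have k2 := mul_le_mul_of_nonneg_right (min_le_right (c / 4) (β / 2)) hW
  nlinarith

/-- Sum-zero deviations decay exponentially, at a uniform rate. -/
lemma followingFlow_decay {N : ℕ} [NeZero N] {lam β : ℝ} (hlam : 0 < lam) (hβ : 0 < β) :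
    ∃ κ > 0, ∀ z : (Fin N → ℝ) × (Fin N → ℝ), ∑ k, z.1 k = 0 → ∃ C, 0 ≤ C ∧
      ∀ n t, 0 ≤ t → |(followingFlow N lam β t z).1 n| ≤ C * Real.exp (-κ * t) := by
  obtain ⟨M, hM, κ, hκ, hE⟩ := energy_dissipation (N := N) hlam hβ
  refine ⟨κ, hκ, fun z hz => ?_⟩
  set y := fun t => (followingFlow N lam β t z).1 with hy
  set w := fun t => (followingFlow N lam β t z).2 with hw
  set F := fun t => ∑ k, (y t k ^ 2 + M * w t k ^ 2) with hF
  have hF0 : ∀ t, 0 ≤ F t := fun t => Finset.sum_nonneg fun k _ => by positivity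
  have hdF : ∀ t, HasDerivAt F (∑ k, (2 * y t k * (lam * (y t (k + 1) - y t k)
      - β * (w t (k + 1) - w t k)) + M * (2 * w t k * (-β * w t k)))) t := by
    intro t
    refine HasDerivAt.fun_sum fun k _ => ?_
    have h1 := (hasDerivAt_followingFlow_fst lam β z k t).pow 2
    have h2 := ((hasDerivAt_followingFlow_snd lam β z k t).pow 2).const_mul M
    rw [followingFlow_generator] at h1
    refine (h1.add h2).congr_deriv ?_
    simp [followingGenerator_apply, hy, hw]
  -- Gronwall's argument for the weighted energy `F`, in integrating-factor form.
  have hanti : Antitone fun t => Real.exp (2 * κ * t) * F t := by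
    have hd : ∀ t, HasDerivAt (fun t => Real.exp (2 * κ * t) * F t) _ t := fun t =>
      (((hasDerivAt_id t).const_mul (2 * κ)).exp).mul (hdF t)
    refine antitone_of_hasDerivAt_nonpos hd fun t => ?_
    have := hE (y t) (w t) (by rw [hy]; simpa [hz] using sum_followingFlow_fst lam β z t)
    have h3 := mul_le_mul_of_nonneg_left this (Real.exp_pos (2 * κ * t)).le
    simp only [id, mul_one, Pi.zero_apply]
    simp only [hF] at h3 ⊢
    linarith
  refine ⟨Real.sqrt (F 0), Real.sqrt_nonneg _, fun n t ht => ?_⟩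
  have h1 := hanti ht
  simp only [mul_zero, Real.exp_zero, one_mul] at h1
  have h2 : y t n ^ 2 ≤ F t := by
    refine le_trans ?_ (Finset.single_le_sum (f := fun k => y t k ^ 2 + M * w t k ^ 2)
      (fun k _ => by positivity) (Finset.mem_univ n))
    have : 0 ≤ M * w t n ^ 2 := by positivity
    linarith
  have h3 : (Real.exp (κ * t) * |y t n|) ^ 2 ≤ F 0 := by
    have e : Real.exp (κ * t) ^ 2 = Real.exp (2 * κ * t) := by
      rw [← Real.exp_nat_mul]; congr 1; push_cast; ring
    rw [mul_pow, sq_abs, e]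
    exact (mul_le_mul_of_nonneg_left h2 (Real.exp_pos _).le).trans h1
  have h4 := Real.le_sqrt_of_sq_le h3
  calc |y t n| = (Real.exp (κ * t) * |y t n|) * Real.exp (-κ * t) := by
        rw [mul_right_comm, ← Real.exp_add]; simp
    _ ≤ _ := by gcongr

/-! ### Kernels and the stationary covariance. -/

/-- Initial state of the linear system excited by a unit noise of particle `m`. -/
def noiseInput {N : ℕ} [NeZero N] (m : Fin N) : (Fin N → ℝ) × (Fin N → ℝ) :=
  (fun k => (Pi.single m 1 : Fin N → ℝ) (k + 1) - (Pi.single m 1 : Fin N → ℝ) k, Pi.single m 1)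

/-- Response of deviation `n` to the initial noise of particle `m`; it is also the kernel of the
stochastic convolution. -/
def noiseKernel {N : ℕ} [NeZero N] (lam β : ℝ) (n m : Fin N) (t : ℝ) : ℝ :=
  -(1 / β) * (followingFlow N lam β t (0, Pi.single m 1)).1 n

/-- The derivative of `noiseKernel`. -/
def noiseKernelDeriv {N : ℕ} [NeZero N] (lam β : ℝ) (n m : Fin N) (t : ℝ) : ℝ :=
  (followingFlow N lam β t (noiseInput m)).1 n

/-- Response of deviation `n` to the initial deviation of particle `m`. -/
def deviationKernel {N : ℕ} [NeZero N] (lam β : ℝ) (n m : Fin N) (t : ℝ) : ℝ :=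
  (followingFlow N lam β t (fun k => (Pi.single m 1 : Fin N → ℝ) k - 1 / N, 0)).1 n

section Kernels

variable {N : ℕ} [NeZero N] {lam β : ℝ}

/-- The generator sends `(0, e_m)` to `-β` times `noiseInput m`; the factor `-(1 / β)` in
`noiseKernel` cancels this. -/
lemma hasDerivAt_noiseKernel (hβ : β ≠ 0) (n m : Fin N) (t : ℝ) :
    HasDerivAt (noiseKernel lam β n m) (noiseKernelDeriv lam β n m t) t := by
  have h := (hasDerivAt_followingFlow_fst lam β (0, Pi.single m 1) n t).const_mul (-(1 / β))
  refine h.congr_deriv ?_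
  have e : followingGenerator N lam β (0, Pi.single m 1) = (-β) • noiseInput m := by
    ext k <;> simp [followingGenerator_apply, noiseInput]
  rw [e, map_smul]
  simp only [Prod.smul_fst, Pi.smul_apply, smul_eq_mul, noiseKernelDeriv]
  field_simp

lemma continuous_noiseKernel (n m : Fin N) : Continuous (noiseKernel lam β n m) :=
  continuous_const.mul (continuous_followingFlow_fst lam β _ n)

lemma continuous_noiseKernelDeriv (n m : Fin N) : Continuous (noiseKernelDeriv lam β n m) :=
  continuous_followingFlow_fst lam β _ n

lemma noiseKernel_zero (n m : Fin N) : noiseKernel lam β n m 0 = 0 := by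
  simp [noiseKernel, followingFlow_zero]

/-- With at least two particles, the noise of particle `0` enters its own spacing only through the
term `-ξ_0`; for a single particle it would cancel. -/
lemma noiseKernelDeriv_zero (hN : 2 ≤ N) : noiseKernelDeriv lam β (0 : Fin N) 0 0 = -1 := by
  have : Nontrivial (Fin N) := Fin.nontrivial_iff_two_le.2 hN
  have h1 : (1 : Fin N) ≠ 0 := by
    rw [Ne, Fin.ext_iff, Fin.val_one', Nat.mod_eq_of_lt hN]
    simp
  simp [noiseKernelDeriv, followingFlow_zero, noiseInput, h1]

lemma noiseKernel_shift (j n m : Fin N) (t : ℝ) :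
    noiseKernel lam β (n + j) (m + j) t = noiseKernel lam β n m t := by
  have e : ((0, Pi.single m 1) : (Fin N → ℝ) × (Fin N → ℝ)) =
      ringShift N j (0, Pi.single (m + j) 1) := by
    ext k <;> simp [ringShift_apply, Pi.single_apply]
  rw [noiseKernel, noiseKernel, e, followingFlow_shift, ringShift_apply]

lemma noiseKernel_decay (hlam : 0 < lam) (hβ : 0 < β) :
    ∃ κ > 0, ∃ C, 0 ≤ C ∧ ∀ (n m : Fin N) (t : ℝ), 0 ≤ t →
      |noiseKernel lam β n m t| ≤ C * Real.exp (-κ * t) := by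
  obtain ⟨κ, hκ, h⟩ := followingFlow_decay (N := N) hlam hβ
  choose C hC0 hC using fun m : Fin N => h (0, Pi.single m 1) (by simp)
  refine ⟨κ, hκ, 1 / β * ∑ m, C m,
    mul_nonneg (by positivity) (Finset.sum_nonneg fun m _ => hC0 m), fun n m t ht => ?_⟩
  rw [noiseKernel, abs_mul, abs_neg, abs_of_pos (by positivity : 0 < 1 / β), mul_assoc]
  refine mul_le_mul_of_nonneg_left ((hC m n t ht).trans ?_) (by positivity)
  exact mul_le_mul_of_nonneg_right
    (Finset.single_le_sum (fun m _ => hC0 m) (Finset.mem_univ m)) (Real.exp_pos _).le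

lemma tendsto_zero_of_exp_bound {f : ℝ → ℝ} {κ C : ℝ} (hκ : 0 < κ)
    (h : ∀ t, 0 ≤ t → |f t| ≤ C * Real.exp (-κ * t)) : Tendsto f atTop (𝓝 0) := by
  have h1 : Tendsto (fun t => C * Real.exp (-κ * t)) atTop (𝓝 0) := by
    have : Tendsto (fun t : ℝ => -κ * t) atTop atBot :=
      tendsto_id.const_mul_atTop_of_neg (by linarith)
    simpa using (Real.tendsto_exp_atBot.comp this).const_mul C
  refine squeeze_zero_norm' ?_ h1
  filter_upwards [eventually_ge_atTop 0] with t ht using h t ht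

lemma tendsto_noiseKernel (hlam : 0 < lam) (hβ : 0 < β) (n m : Fin N) :
    Tendsto (noiseKernel lam β n m) atTop (𝓝 0) := by
  obtain ⟨κ, hκ, C, -, h⟩ := noiseKernel_decay (N := N) hlam hβ
  exact tendsto_zero_of_exp_bound hκ (h n m)

lemma tendsto_deviationKernel (hlam : 0 < lam) (hβ : 0 < β) (n m : Fin N) :
    Tendsto (deviationKernel lam β n m) atTop (𝓝 0) := by
  obtain ⟨κ, hκ, h⟩ := followingFlow_decay (N := N) hlam hβ
  -- Subtracting `1 / N` projects the unit vector onto zero-sum deviations, which the decay estimate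
  -- requires.
  obtain ⟨C, -, hC⟩ := h (fun k => (Pi.single m 1 : Fin N → ℝ) k - 1 / N, 0) (by
    simp [Finset.sum_sub_distrib, NeZero.ne N])
  exact tendsto_zero_of_exp_bound hκ (hC n)

lemma integrableOn_noiseKernel_mul (hlam : 0 < lam) (hβ : 0 < β) (n n' m : Fin N) {τ : ℝ}
    (hτ : 0 ≤ τ) :
    IntegrableOn (fun v => noiseKernel lam β n m v * noiseKernel lam β n' m (v + τ)) (Ioi 0) := by
  obtain ⟨κ, hκ, C, hC, h⟩ := noiseKernel_decay (N := N) hlam hβ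
  have hi : IntegrableOn (fun v => C * C * Real.exp (-κ * v)) (Ioi 0) :=
    (integrableOn_exp_mul_Ioi (by linarith) 0).const_mul _
  refine hi.mono' ?_ ?_
  · exact ((continuous_noiseKernel n m).mul
      ((continuous_noiseKernel n' m).comp (by fun_prop))).aestronglyMeasurable
  · refine (ae_restrict_iff' measurableSet_Ioi).2 (ae_of_all _ fun v (hv : 0 < v) => ?_)
    rw [norm_mul, Real.norm_eq_abs, Real.norm_eq_abs]
    have h1 := h n m v hv.le
    have h2 := h n' m (v + τ) (by linarith)
    have h3 : C * Real.exp (-κ * (v + τ)) ≤ C := by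
      refine mul_le_of_le_one_right hC (Real.exp_le_one_iff.2 ?_)
      have : 0 ≤ κ * (v + τ) := by positivity
      linarith
    calc _ ≤ (C * Real.exp (-κ * v)) * C :=
          mul_le_mul h1 (h2.trans h3) (abs_nonneg _) (by positivity)
      _ = _ := by ring

/-- Stationary covariance of the deviations of particles `0` and `j` for noise amplitude one. -/
def stationaryCovariance (N : ℕ) [NeZero N] (lam β : ℝ) (j : Fin N) (τ : ℝ) : ℝ :=
  ∑ m : Fin N, ∫ v in Ioi (0 : ℝ), noiseKernel lam β 0 m v * noiseKernel lam β j m (v + τ)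

/-- Relabelling the noise index by `m + n` and using cyclic invariance reduces particle `n` to
particle `0`. -/
lemma sum_integral_noiseKernel (n j : Fin N) (τ : ℝ) :
    ∑ m : Fin N, ∫ v in Ioi (0 : ℝ), noiseKernel lam β n m v * noiseKernel lam β (n + j) m (v + τ)
      = stationaryCovariance N lam β j τ := by
  rw [stationaryCovariance, ← Equiv.sum_comp (Equiv.addRight n)]
  refine Finset.sum_congr rfl fun m _ => integral_congr_ae (ae_of_all _ fun v => ?_)
  have e1 := noiseKernel_shift (lam := lam) (β := β) n 0 m v
  have e2 := noiseKernel_shift (lam := lam) (β := β) n j m (v + τ)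
  rw [zero_add] at e1
  simp only [Equiv.coe_addRight]
  rw [e1, add_comm n j, e2]

/-- If the term `m = 0` vanished, continuity would force `g_{0,0} = 0` on `[0, ∞)`, against its
slope `-1` at `0`. -/
lemma stationaryCovariance_pos (hN : 2 ≤ N) (hlam : 0 < lam) (hβ : 0 < β) :
    0 < stationaryCovariance N lam β 0 0 := by
  have hnn : ∀ m : Fin N, ∀ v, 0 ≤ noiseKernel lam β 0 m v * noiseKernel lam β 0 m (v + 0) := by
    intro m v; rw [add_zero]; exact mul_self_nonneg _
  refine Finset.sum_pos' (fun m _ => integral_nonneg (hnn m)) ⟨0, Finset.mem_univ _, ?_⟩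
  refine lt_of_le_of_ne (integral_nonneg (hnn 0)) fun h0 => ?_
  have hz := (setIntegral_eq_zero_iff_of_nonneg_ae (ae_of_all _ (hnn 0))
    (integrableOn_noiseKernel_mul hlam hβ 0 0 0 le_rfl)).1 h0.symm
  have hcont : Continuous fun v => noiseKernel lam β (0 : Fin N) 0 v *
      noiseKernel lam β (0 : Fin N) 0 (v + 0) :=
    (continuous_noiseKernel 0 0).mul ((continuous_noiseKernel 0 0).comp (by fun_prop))
  have hz' := Measure.eqOn_open_of_ae_eq hz isOpen_Ioi hcont.continuousOn continuousOn_const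
  have hzero : ∀ v ∈ Ici (0 : ℝ), noiseKernel lam β (0 : Fin N) 0 v = 0 := by
    intro v hv
    rcases (mem_Ici.1 hv).eq_or_lt with rfl | hv
    · exact noiseKernel_zero 0 0
    · simpa using hz' (mem_Ioi.2 hv)
  have hd := (hasDerivAt_noiseKernel (lam := lam) hβ.ne' (0 : Fin N) 0 0).hasDerivWithinAt (s := Ici 0)
  have hd0 : HasDerivWithinAt (noiseKernel lam β (0 : Fin N) 0) 0 (Ici 0) 0 :=
    (hasDerivWithinAt_const 0 (Ici 0) (0 : ℝ)).congr hzero (hzero 0 self_mem_Ici)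
  have := (uniqueDiffOn_Ici (0 : ℝ) 0 self_mem_Ici).eq_deriv _ hd hd0
  rw [noiseKernelDeriv_zero hN] at this
  norm_num at this

end Kernels

/-! ### Integration by parts against the Brownian covariance. -/

/-- The covariance of two Wiener integrals of kernels vanishing at zero, by parts. -/
lemma integral_integral_mul_min {g k g' k' : ℝ → ℝ} (hg : ∀ t, HasDerivAt g (g' t) t)
    (hk : ∀ t, HasDerivAt k (k' t) t) (hg' : Continuous g') (hk' : Continuous k')
    (hg0 : g 0 = 0) (hk0 : k 0 = 0) {t τ : ℝ} (ht : 0 ≤ t) (hτ : 0 ≤ τ) :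
    ∫ s in (0 : ℝ)..t, ∫ r in (0 : ℝ)..(t + τ), g' (t - s) * k' (t + τ - r) * min s r =
      ∫ v in (0 : ℝ)..t, g v * k (v + τ) := by
  have hgc : Continuous g := continuous_iff_continuousAt.2 fun t => (hg t).continuousAt
  have hkc : Continuous k := continuous_iff_continuousAt.2 fun t => (hk t).continuousAt
  set Φ : ℝ → ℝ := fun s => ∫ r in (0 : ℝ)..s, k (t + τ - r) with hΦ
  have hinner : ∀ s ∈ Icc 0 t,
      ∫ r in (0 : ℝ)..(t + τ), k' (t + τ - r) * min s r = Φ s := by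
    intro s hs
    have hkd : ∀ r, HasDerivAt (fun r => -k (t + τ - r)) (k' (t + τ - r)) r := by
      intro r
      have := ((hk (t + τ - r)).comp r ((hasDerivAt_id r).const_sub (t + τ))).fun_neg
      simpa [Function.comp_def] using this
    have hc : Continuous fun r => k' (t + τ - r) * min s r := by fun_prop
    -- Split at the kink `r = s` of the minimum. The two boundary terms `s * k (t + τ - s)` cancel,
    -- leaving `Φ s`.
    rw [← intervalIntegral.integral_add_adjacent_intervals (b := s)
      (hc.intervalIntegrable _ _) (hc.intervalIntegrable _ _)]
    have e1 : ∫ r in (0 : ℝ)..s, k' (t + τ - r) * min s r =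
        ∫ r in (0 : ℝ)..s, r * k' (t + τ - r) := by
      refine intervalIntegral.integral_congr fun r hr => ?_
      rw [uIcc_of_le hs.1] at hr
      simp only [min_eq_right hr.2]; ring
    have e2 : ∫ r in s..(t + τ), k' (t + τ - r) * min s r =
        ∫ r in s..(t + τ), k' (t + τ - r) * s := by
      refine intervalIntegral.integral_congr fun r hr => ?_
      rw [uIcc_of_le (by linarith [hs.2])] at hr
      simp only [min_eq_left hr.1]
    rw [e1, e2, intervalIntegral.integral_mul_const,
      intervalIntegral.integral_eq_sub_of_hasDerivAt (fun r _ => hkd r)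
        ((by fun_prop : Continuous fun r => k' (t + τ - r)).intervalIntegrable _ _),
      intervalIntegral.integral_mul_deriv_eq_deriv_mul (u' := fun _ => 1)
        (fun r _ => hasDerivAt_id' r) (fun r _ => hkd r) (continuous_const.intervalIntegrable _ _)
        ((by fun_prop : Continuous fun r => k' (t + τ - r)).intervalIntegrable _ _)]
    simp only [sub_self, hk0, one_mul, intervalIntegral.integral_neg, hΦ]
    ring
  have hgd : ∀ s, HasDerivAt (fun s => -g (t - s)) (g' (t - s)) s := by
    intro s
    have := ((hg (t - s)).comp s ((hasDerivAt_id s).const_sub t)).fun_neg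
    simpa [Function.comp_def] using this
  have hkc' : Continuous fun r => k (t + τ - r) := by fun_prop
  have hΦd : ∀ s, HasDerivAt Φ (k (t + τ - s)) s := fun s =>
    intervalIntegral.integral_hasDerivAt_right (hkc'.intervalIntegrable _ _)
      (hkc'.stronglyMeasurableAtFilter _ _) hkc'.continuousAt
  calc _ = ∫ s in (0 : ℝ)..t, Φ s * g' (t - s) := by
        refine intervalIntegral.integral_congr fun s hs => ?_
        rw [uIcc_of_le ht] at hs
        simp only [mul_assoc]
        rw [intervalIntegral.integral_const_mul, hinner s hs, mul_comm]
    _ = ∫ s in (0 : ℝ)..t, g (t - s) * k (t - s + τ) := by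
        -- The boundary terms vanish because `Φ 0 = 0` and `g 0 = 0`.
        rw [intervalIntegral.integral_mul_deriv_eq_deriv_mul (fun s _ => hΦd s)
          (fun s _ => hgd s) (hkc'.intervalIntegrable _ _)
          ((by fun_prop : Continuous fun s => g' (t - s)).intervalIntegrable _ _)]
        simp only [hΦ, sub_self, hg0, intervalIntegral.integral_same, mul_neg, mul_zero, zero_mul,
          neg_zero, intervalIntegral.integral_neg]
        rw [zero_sub, neg_neg]
        refine intervalIntegral.integral_congr fun s _ => ?_
        simp only [add_sub_right_comm]
        ring
    _ = _ := by
        simpa using intervalIntegral.integral_comp_sub_left (fun v => g v * k (v + τ)) t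
          (a := 0) (b := t)

/-! ### Square-integrable Fubini arguments for processes. -/

section Fubini

variable {Ω : Type*} [MeasurableSpace Ω] {P : Measure Ω}

/-- A process with almost surely continuous paths is jointly measurable up to null sets. -/
lemma aestronglyMeasurable_uncurry_of_ae_continuous [SFinite P] {X : ℝ → Ω → ℝ}
    (hX : ∀ s, AEMeasurable (X s) P) (hc : ∀ᵐ ω ∂P, Continuous fun s => X s ω)
    (μ : Measure ℝ) [SFinite μ] :
    AEStronglyMeasurable (fun p : ℝ × Ω => X p.1 p.2) (μ.prod P) := by
  -- Measurable versions are needed only at the countably many grid times, so one null set suffices.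
  -- Rounding time down to the grid then approximates the process along continuous paths.
  choose Y hYm hYe using fun (k : ℕ) (j : ℤ) => hX (j / (k + 1))
  have hm : ∀ k, Measurable fun p : ℤ × Ω => Y k p.1 p.2 := fun k =>
    measurable_from_prod_countable_right fun j => hYm k j
  have hfm : ∀ k : ℕ, Measurable fun p : ℝ × Ω => Y k ⌊p.1 * (k + 1)⌋ p.2 := by
    intro k
    have hfl : Measurable fun p : ℝ × Ω => ⌊p.1 * (k + 1)⌋ :=
      Int.measurable_floor.comp (measurable_fst.mul_const _)
    exact (hm k).comp (hfl.prodMk measurable_snd)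
  refine aestronglyMeasurable_of_tendsto_ae atTop (fun k => (hfm k).aestronglyMeasurable) ?_
  have hboth : ∀ᵐ ω ∂P, (Continuous fun s => X s ω) ∧
      ∀ (k : ℕ) (j : ℤ), X (j / (k + 1)) ω = Y k j ω :=
    hc.and (ae_all_iff.2 fun k => ae_all_iff.2 fun j => hYe k j)
  have hprod : ∀ᵐ p ∂(μ.prod P), (Continuous fun s => X s p.2) ∧
      ∀ (k : ℕ) (j : ℤ), X (j / (k + 1)) p.2 = Y k j p.2 :=
    (Measure.quasiMeasurePreserving_snd (μ := μ) (ν := P)).ae hboth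
  filter_upwards [hprod] with p hp
  simp only [← hp.2]
  refine (hp.1.tendsto p.1).comp ?_
  have hlim : Tendsto (fun k : ℕ => p.1 - 1 / ((k : ℝ) + 1)) atTop (𝓝 p.1) := by
    simpa using tendsto_one_div_add_atTop_nhds_zero_nat.const_sub p.1
  refine tendsto_of_tendsto_of_tendsto_of_le_of_le hlim tendsto_const_nhds (fun k => ?_)
    fun k => ?_
  · have hk : (0 : ℝ) < k + 1 := by positivity
    have := (Int.lt_floor_add_one (p.1 * (k + 1))).le
    rw [sub_le_iff_le_add, ← add_div, le_div_iff₀ hk]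
    exact this
  · have hk : (0 : ℝ) < k + 1 := by positivity
    rw [div_le_iff₀ hk]
    exact Int.floor_le _

lemma memLp_two_uncurry [SFinite P] {μ : Measure ℝ} [SFinite μ] {F : ℝ → Ω → ℝ}
    (hm : AEStronglyMeasurable (fun p : ℝ × Ω => F p.1 p.2) (μ.prod P))
    (h2 : ∀ᵐ s ∂μ, MemLp (F s) 2 P) (hi : Integrable (fun s => ∫ ω, F s ω ^ 2 ∂P) μ) :
    MemLp (fun p : ℝ × Ω => F p.1 p.2) 2 (μ.prod P) := by
  rw [memLp_two_iff_integrable_sq hm]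
  refine (integrable_prod_iff (hm.pow 2)).2 ?_
  refine ⟨h2.mono fun s hs => hs.integrable_sq, ?_⟩
  simpa using hi

/-- Jensen's inequality for the square, for a finite measure. -/
lemma sq_integral_le_mul_integral_sq {α : Type*} [MeasurableSpace α] {μ : Measure α}
    [IsFiniteMeasure μ] {f : α → ℝ} (hf : MemLp f 2 μ) :
    (∫ a, f a ∂μ) ^ 2 ≤ μ.real univ * ∫ a, f a ^ 2 ∂μ := by
  have hfi : Integrable f μ := hf.integrable one_le_two
  set J := ∫ a, f a ∂μ with hJ
  -- The integral of `(f - c)²` is minimal at the mean `c = J / μ.real univ`, which gives the claim.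
  have h : ∀ c : ℝ, 0 ≤ ∫ a, f a ^ 2 ∂μ - 2 * c * J + c ^ 2 * μ.real univ := by
    intro c
    have : ∫ a, (f a - c) ^ 2 ∂μ = ∫ a, f a ^ 2 ∂μ - 2 * c * J + c ^ 2 * μ.real univ := by
      have e : ∀ a, (f a - c) ^ 2 = f a ^ 2 - 2 * c * f a + c ^ 2 := fun a => by ring
      simp only [e]
      rw [integral_add (f := fun a => f a ^ 2 - 2 * c * f a)
          (hf.integrable_sq.sub (hfi.const_mul _)) (integrable_const _),
        integral_sub hf.integrable_sq (hfi.const_mul _), integral_const_mul, integral_const]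
      simp [hJ, mul_comm]
    rw [← this]
    exact integral_nonneg fun a => sq_nonneg _
  rcases (measureReal_nonneg (μ := μ) (s := univ)).eq_or_lt with h0 | h0
  · have hμ : μ = 0 := by
      have := (measureReal_eq_zero_iff (μ := μ) (s := univ)).1 h0.symm
      exact Measure.measure_univ_eq_zero.1 this
    simp [hJ, hμ]
  · have := h (J / μ.real univ)
    have e : ∫ a, f a ^ 2 ∂μ - 2 * (J / μ.real univ) * J + (J / μ.real univ) ^ 2 * μ.real univ =
      ∫ a, f a ^ 2 ∂μ - J ^ 2 / μ.real univ := by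
      field_simp; ring
    rw [e, sub_nonneg, div_le_iff₀ h0] at this
    linarith

variable [IsFiniteMeasure P] {μ : Measure ℝ} [IsFiniteMeasure μ] {F : ℝ → Ω → ℝ}

/-- Jensen's inequality in `s` bounds the squared integral by a section integral that is integrable
over `Ω`. -/
lemma memLp_integral_of_memLp_uncurry
    (hF : MemLp (fun p : ℝ × Ω => F p.1 p.2) 2 (μ.prod P)) :
    MemLp (fun ω => ∫ s, F s ω ∂μ) 2 P := by
  have hm : AEStronglyMeasurable (fun ω => ∫ s, F s ω ∂μ) P :=
    hF.1.prod_swap.integral_prod_right'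
  rw [memLp_two_iff_integrable_sq hm]
  have hsq := hF.integrable_sq
  refine (hsq.integral_prod_right.const_mul (μ.real univ)).mono' (hm.pow 2) ?_
  have hsl : ∀ᵐ ω ∂P, AEStronglyMeasurable (fun s => F s ω) μ := hF.1.prod_swap.prodMk_left
  filter_upwards [hsl, hsq.prod_left_ae] with ω h1 h2
  rw [Real.norm_eq_abs, abs_of_nonneg (sq_nonneg _)]
  exact sq_integral_le_mul_integral_sq ((memLp_two_iff_integrable_sq h1).2 h2)

lemma integral_integral_mul_of_memLp_uncurry
    (hF : MemLp (fun p : ℝ × Ω => F p.1 p.2) 2 (μ.prod P)) {H : Ω → ℝ} (hH : MemLp H 2 P) :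
    ∫ ω, (∫ s, F s ω ∂μ) * H ω ∂P = ∫ s, ∫ ω, F s ω * H ω ∂P ∂μ := by
  have hH' : MemLp (fun p : ℝ × Ω => H p.2) 2 (μ.prod P) := hH.comp_snd μ
  have hi : Integrable (fun p : ℝ × Ω => F p.1 p.2 * H p.2) (μ.prod P) := hF.integrable_mul hH'
  simp_rw [← integral_mul_const]
  exact (integral_integral_swap hi).symm

end Fubini

/-! ### Pathwise integrals of Wiener processes and their covariances. -/

lemma ProbabilityTheory.IsBrownianReal.memLp_two {Ω : Type*} [MeasurableSpace Ω]
    {P : Measure Ω} {X : ℝ≥0 → Ω → ℝ} (hX : IsBrownianReal X P)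
    (s : ℝ≥0) : MemLp (X s) 2 P :=
  (hX.toIsPreBrownianReal.isGaussianProcess.hasGaussianLaw_eval s).memLp_two

section Wiener

variable {Ω : Type*} [MeasurableSpace Ω] {P : Measure Ω} [IsProbabilityMeasure P] {N : ℕ}
  {W : Fin N → ℝ≥0 → Ω → ℝ}

/-- The pathwise integral of a kernel against a process indexed by the nonnegative reals. -/
def pathIntegral (X : ℝ≥0 → Ω → ℝ) (h : ℝ → ℝ) (t : ℝ) (ω : Ω) : ℝ :=
  ∫ s in (0 : ℝ)..t, h s * X s.toNNReal ω

lemma integral_wiener_mul (hW : ∀ n, IsBrownianReal (W n) P)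
    (hi : iIndepFun (fun n ω t => W n t ω) P) (m m' : Fin N) (s r : ℝ≥0) :
    ∫ ω, W m s ω * W m' r ω ∂P = if m = m' then ((min s r : ℝ≥0) : ℝ) else 0 := by
  have h := covariance_eq_sub ((hW m).memLp_two s) ((hW m').memLp_two r)
  have h0 : P[W m s] = 0 := (hW m).toIsPreBrownianReal.integral_eval s
  rw [h0, zero_mul, sub_zero] at h
  have e : ∫ ω, W m s ω * W m' r ω ∂P = cov[W m s, W m' r; P] := h.symm
  rw [e]
  split_ifs with hm
  · subst hm
    exact (hW m).toIsPreBrownianReal.covariance_eval s r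
  · have hind := (hi.indepFun hm).comp (measurable_pi_apply s) (measurable_pi_apply r)
    exact IndepFun.covariance_eq_zero hind ((hW m).memLp_two s) ((hW m').memLp_two r)

lemma memLp_uncurry_wiener {X : ℝ≥0 → Ω → ℝ} (hX : IsBrownianReal X P) {h : ℝ → ℝ}
    (hh : Continuous h) (t : ℝ) :
    MemLp (fun p : ℝ × Ω => h p.1 * X p.1.toNNReal p.2) 2
      ((volume.restrict (Ioc 0 t)).prod P) := by
  have hm : AEStronglyMeasurable (fun p : ℝ × Ω => X p.1.toNNReal p.2)
      ((volume.restrict (Ioc 0 t)).prod P) := by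
    refine aestronglyMeasurable_uncurry_of_ae_continuous (X := fun s => X s.toNNReal)
      (fun s => hX.toIsPreBrownianReal.aemeasurable _) ?_ _
    filter_upwards [hX.cont] with ω hω
    exact hω.comp continuous_real_toNNReal
  refine memLp_two_uncurry (F := fun s ω => h s * X s.toNNReal ω) ?_ ?_ ?_
  · exact (hh.measurable.comp measurable_fst).aestronglyMeasurable.mul hm
  · exact ae_of_all _ fun s => (hX.memLp_two _).const_mul (h s)
  · have e : ∀ s, ∫ ω, (h s * X s.toNNReal ω) ^ 2 ∂P = h s ^ 2 * (s.toNNReal : ℝ) := by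
      intro s
      have hv := covariance_eq_sub (hX.memLp_two s.toNNReal) (hX.memLp_two s.toNNReal)
      have h0 : P[X s.toNNReal] = 0 := hX.toIsPreBrownianReal.integral_eval _
      rw [h0, zero_mul, sub_zero, hX.toIsPreBrownianReal.covariance_eval, min_self] at hv
      rw [hv, ← integral_const_mul]
      refine integral_congr_ae (ae_of_all _ fun ω => ?_)
      simp only [Pi.mul_apply]; ring
    simp only [e]
    exact ((by fun_prop : Continuous fun s : ℝ => h s ^ 2 * (s.toNNReal : ℝ)).integrableOn_Icc
      (a := 0) (b := t)).mono_set Ioc_subset_Icc_self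

lemma memLp_pathIntegral {X : ℝ≥0 → Ω → ℝ} (hX : IsBrownianReal X P) {h : ℝ → ℝ}
    (hh : Continuous h) {t : ℝ} (ht : 0 ≤ t) : MemLp (pathIntegral X h t) 2 P := by
  have := memLp_integral_of_memLp_uncurry
    (F := fun s ω => h s * X s.toNNReal ω) (memLp_uncurry_wiener hX hh t)
  have e : pathIntegral X h t = fun ω => ∫ s in Ioc 0 t, h s * X s.toNNReal ω := by
    ext ω
    rw [pathIntegral, intervalIntegral.integral_of_le ht]
  rw [e]
  exact this

lemma integral_pathIntegral_mul {X : ℝ≥0 → Ω → ℝ} (hX : IsBrownianReal X P) {h : ℝ → ℝ}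
    (hh : Continuous h) {t : ℝ} (ht : 0 ≤ t) {H : Ω → ℝ} (hH : MemLp H 2 P) :
    ∫ ω, pathIntegral X h t ω * H ω ∂P =
      ∫ s in (0 : ℝ)..t, h s * ∫ ω, X s.toNNReal ω * H ω ∂P := by
  have := integral_integral_mul_of_memLp_uncurry
    (F := fun s ω => h s * X s.toNNReal ω) (memLp_uncurry_wiener hX hh t) hH
  simp only [pathIntegral, intervalIntegral.integral_of_le ht, ← integral_const_mul]
  simpa only [mul_assoc] using this

lemma integral_pathIntegral {X : ℝ≥0 → Ω → ℝ} (hX : IsBrownianReal X P) {h : ℝ → ℝ}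
    (hh : Continuous h) {t : ℝ} (ht : 0 ≤ t) : ∫ ω, pathIntegral X h t ω ∂P = 0 := by
  have := integral_pathIntegral_mul hX hh ht (memLp_const (1 : ℝ))
  simpa [hX.toIsPreBrownianReal.integral_eval] using this

/-- Fubini is applied twice: first with the whole second path integral as the fixed
square-integrable factor, then with `W m` at a fixed time. -/
lemma covariance_pathIntegral (hW : ∀ n, IsBrownianReal (W n) P)
    (hi : iIndepFun (fun n ω t => W n t ω) P) (m m' : Fin N) {h k : ℝ → ℝ}
    (hh : Continuous h) (hk : Continuous k) {t u : ℝ} (ht : 0 ≤ t) (hu : 0 ≤ u) :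
    cov[pathIntegral (W m) h t, pathIntegral (W m') k u; P] = if m = m' then
      ∫ s in (0 : ℝ)..t, ∫ r in (0 : ℝ)..u, h s * k r * min s r else 0 := by
  rw [covariance_eq_sub (memLp_pathIntegral (hW m) hh ht) (memLp_pathIntegral (hW m') hk hu),
    integral_pathIntegral (hW m) hh ht, zero_mul, sub_zero]
  have e1 := integral_pathIntegral_mul (hW m) hh ht (memLp_pathIntegral (hW m') hk hu)
  refine Eq.trans e1 ?_
  have e2 : ∀ s ∈ uIcc 0 t, h s * ∫ ω, W m s.toNNReal ω * pathIntegral (W m') k u ω ∂P =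
      if m = m' then ∫ r in (0 : ℝ)..u, h s * k r * min s r else 0 := by
    intro s hs
    rw [uIcc_of_le ht] at hs
    simp_rw [mul_comm (W m s.toNNReal _)]
    rw [integral_pathIntegral_mul (hW m') hk hu ((hW m).memLp_two _),
      ← intervalIntegral.integral_const_mul]
    have e3 : ∀ r ∈ uIcc 0 u, h s * (k r * ∫ ω, W m' r.toNNReal ω * W m s.toNNReal ω ∂P) =
        if m = m' then h s * k r * min s r else 0 := by
      intro r hr
      rw [uIcc_of_le hu] at hr
      rw [integral_wiener_mul hW hi]
      rcases eq_or_ne m m' with rfl | hm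
      · simp only [if_true, NNReal.coe_min, Real.coe_toNNReal _ hr.1, Real.coe_toNNReal _ hs.1]
        rw [min_comm]; ring
      · simp [hm, hm.symm]
    rw [intervalIntegral.integral_congr e3]
    split_ifs <;> simp
  rw [intervalIntegral.integral_congr e2]
  split_ifs <;> simp

end Wiener

/-! ### Variation of constants along a path. -/

section Path

variable {N : ℕ} [NeZero N] {lam β σ : ℝ}

lemma followingFlow_fst_eq_sum (y : Fin N → ℝ) (hy : ∑ k, y k = 0) (n : Fin N) (t : ℝ) :
    (followingFlow N lam β t (y, 0)).1 n = ∑ m, deviationKernel lam β n m t * y m := by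
  have e : ((y, 0) : (Fin N → ℝ) × (Fin N → ℝ)) =
      ∑ m, y m • (fun k => (Pi.single m 1 : Fin N → ℝ) k - 1 / N, 0) := by
    ext k
    · simp [Prod.fst_sum, Finset.sum_apply, mul_sub, Finset.sum_sub_distrib, ← Finset.sum_mul, hy,
        Pi.single_apply]
    · simp [Prod.snd_sum, Finset.sum_apply]
  rw [e, map_sum, Prod.fst_sum, Finset.sum_apply]
  refine Finset.sum_congr rfl fun m _ => ?_
  rw [map_smul, Prod.smul_fst, Pi.smul_apply, smul_eq_mul, mul_comm, deviationKernel]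

/-- Variation of constants for a path of the deviations driven by Ornstein-Uhlenbeck noises. -/
lemma deviation_path_eq (hβ : β ≠ 0) {y ξ : Fin N → ℝ → ℝ} {w : Fin N → ℝ≥0 → ℝ}
    (hξ : ∀ n, ContinuousOn (ξ n) (Ici 0))
    (hnoise : ∀ n, ∀ t : ℝ≥0, ξ n t = ξ n 0 - β * (∫ s in (0 : ℝ)..t, ξ n s) + σ * w n t)
    (hy : ∀ n t, 0 ≤ t → HasDerivWithinAt (y n)
      (lam * (y (n + 1) t - y n t) + (ξ (n + 1) t - ξ n t)) (Ici 0) t)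
    (hy0 : ∑ n, y n 0 = 0) (hw : ∀ n, Continuous (w n)) (n : Fin N) {t : ℝ} (ht : 0 ≤ t) :
    y n t = (∑ m, deviationKernel lam β n m t * y m 0 + ∑ m, noiseKernel lam β n m t * ξ m 0)
      + ∑ m, σ * ∫ s in (0 : ℝ)..t, noiseKernelDeriv lam β n m (t - s) * w m s.toNNReal := by
  -- The noise is controlled only for `t ≥ 0`; freezing it at its initial value on the left makes
  -- `X` differentiable everywhere.
  set X : Fin N → ℝ → ℝ := fun k s => ∫ r in (0 : ℝ)..s, ξ k (max r 0) with hX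
  have hξc : ∀ k, Continuous fun r => ξ k (max r 0) := fun k =>
    (hξ k).comp_continuous (by fun_prop) fun r => le_max_right r 0
  have hXd : ∀ k s, HasDerivAt (X k) (ξ k (max s 0)) s := fun k s =>
    intervalIntegral.integral_hasDerivAt_right ((hξc k).intervalIntegrable _ _)
      ((hξc k).stronglyMeasurableAtFilter _ _) (hξc k).continuousAt
  have hXeq : ∀ k s, 0 ≤ s → X k s = ∫ r in (0 : ℝ)..s, ξ k r := by
    intro k s hs
    refine intervalIntegral.integral_congr fun r hr => ?_
    rw [uIcc_of_le hs] at hr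
    simp only [max_eq_left hr.1]
  have hξeq : ∀ k s, 0 ≤ s → ξ k s = ξ k 0 + σ * w k s.toNNReal - β * X k s := by
    intro k s hs
    have := hnoise k s.toNNReal
    rw [Real.coe_toNNReal _ hs, ← hXeq k s hs] at this
    rw [this]; ring
  -- Writing `ξ = c - β X` leaves a forcing that is merely continuous; `W` is never differentiated.
  set c : Fin N → ℝ → ℝ := fun m s => ξ m 0 + σ * w m s.toNNReal with hc
  have hcc : ∀ m, Continuous (c m) := fun m =>
    continuous_const.add (continuous_const.mul ((hw m).comp continuous_real_toNNReal))
  set z : ℝ → (Fin N → ℝ) × (Fin N → ℝ) := fun s => (fun k => y k s, fun k => X k s) with hz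
  have hzc : ContinuousOn z (Icc 0 t) := by
    refine ContinuousOn.prodMk (continuousOn_pi.2 fun k => ?_) (continuousOn_pi.2 fun k => ?_)
    · exact fun s hs => ((hy k s hs.1).continuousWithinAt).mono Icc_subset_Ici_self
    · exact fun s _ => (hXd k s).continuousAt.continuousWithinAt
  have hzd : ∀ s ∈ Ioo 0 t, HasDerivAt z
      (followingGenerator N lam β (z s) + ∑ m, c m s • noiseInput m) s := by
    intro s hs
    have hsum : ∑ m, c m s • (noiseInput m : (Fin N → ℝ) × (Fin N → ℝ)) =
        (fun k => c (k + 1) s - c k s, fun k => c k s) := by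
      ext k
      · simp [Prod.fst_sum, Finset.sum_apply, noiseInput, Pi.single_apply, mul_sub,
          Finset.sum_sub_distrib]
      · simp [Prod.snd_sum, Finset.sum_apply, noiseInput, Pi.single_apply]
    rw [hsum, followingGenerator_apply]
    refine HasDerivAt.prodMk (hasDerivAt_pi.2 fun k => ?_) (hasDerivAt_pi.2 fun k => ?_)
    · refine ((hy k s hs.1.le).hasDerivAt (Ici_mem_nhds hs.1)).congr_deriv ?_
      rw [hξeq (k + 1) s hs.1.le, hξeq k s hs.1.le]
      simp only [hz, hc, Pi.add_apply]
      ring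
    · refine (hXd k s).congr_deriv ?_
      rw [max_eq_left hs.1.le, hξeq k s hs.1.le]
      simp only [hz, hc, Pi.add_apply]
      ring
  have hflow : ∀ s, HasDerivAt (fun s => followingFlow N lam β (t - s))
      (-(followingFlow N lam β (t - s) * followingGenerator N lam β)) s := by
    intro s
    have := (hasDerivAt_followingFlow_op (N := N) lam β (t - s)).scomp s
      ((hasDerivAt_id s).const_sub t)
    simpa [Function.comp_def] using this
  have hflowc : Continuous fun s => followingFlow N lam β (t - s) :=
    continuous_iff_continuousAt.2 fun s => (hflow s).continuousAt
  -- Duhamel's formula: in the derivative of the flow at `t - s` applied to `z s`, the generator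
  -- terms cancel and only the forcing survives.
  have hint := intervalIntegral.integral_eq_sub_of_hasDerivAt_of_le
    (f := fun s => (followingFlow N lam β (t - s) (z s)).1 n)
    (f' := fun s => ∑ m, c m s * noiseKernelDeriv lam β n m (t - s)) ht
    (((continuous_apply n).comp continuous_fst).comp_continuousOn
      (hflowc.continuousOn.clm_apply hzc))
    (fun s hs => by
      have h := (hflow s).clm_apply (hzd s hs)
      have h' := hasDerivAt_pi.1 h.fst n
      refine h'.congr_deriv ?_
      simp only [_root_.neg_apply, mul_apply_eq_comp, map_add,
        neg_add_cancel_left, map_sum, map_smul, Prod.fst_sum, Finset.sum_apply, Prod.smul_fst,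
        Pi.smul_apply, smul_eq_mul, noiseKernelDeriv])
    ((continuous_finsetSum _ fun m _ => (hcc m).mul
      ((continuous_noiseKernelDeriv n m).comp (by fun_prop))).intervalIntegrable _ _)
  have hz0 : z 0 = (fun k => y k 0, 0) := by
    simp only [hz, hX, intervalIntegral.integral_same]
    rfl
  simp only [sub_self, followingFlow_zero, sub_zero] at hint
  rw [hz0, followingFlow_fst_eq_sum _ hy0] at hint
  have hgc : ∀ m, Continuous fun s => noiseKernelDeriv lam β n m (t - s) := fun m =>
    (continuous_noiseKernelDeriv n m).comp (by fun_prop)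
  have hterm : ∀ m, ∫ s in (0 : ℝ)..t, c m s * noiseKernelDeriv lam β n m (t - s) =
      noiseKernel lam β n m t * ξ m 0 +
        σ * ∫ s in (0 : ℝ)..t, noiseKernelDeriv lam β n m (t - s) * w m s.toNNReal := by
    intro m
    have hwc : Continuous fun s : ℝ => w m s.toNNReal := (hw m).comp continuous_real_toNNReal
    have e : ∀ s, c m s * noiseKernelDeriv lam β n m (t - s) =
        ξ m 0 * noiseKernelDeriv lam β n m (t - s) +
          σ * (noiseKernelDeriv lam β n m (t - s) * w m s.toNNReal) := fun s => by
      simp only [hc]; ring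
    have h1 : Continuous fun s => ξ m 0 * noiseKernelDeriv lam β n m (t - s) :=
      continuous_const.mul (hgc m)
    have h2 : Continuous fun s => σ * (noiseKernelDeriv lam β n m (t - s) * w m s.toNNReal) :=
      continuous_const.mul ((hgc m).mul hwc)
    simp only [e]
    rw [intervalIntegral.integral_add (h1.intervalIntegrable _ _) (h2.intervalIntegrable _ _),
      intervalIntegral.integral_const_mul, intervalIntegral.integral_const_mul,
      intervalIntegral.integral_comp_sub_left (fun v => noiseKernelDeriv lam β n m v) t,
      sub_self, sub_zero, intervalIntegral.integral_eq_sub_of_hasDerivAt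
        (fun s _ => hasDerivAt_noiseKernel hβ n m s)
        ((continuous_noiseKernelDeriv n m).intervalIntegrable _ _), noiseKernel_zero]
    ring
  have hcg : ∀ m, Continuous fun s => c m s * noiseKernelDeriv lam β n m (t - s) := fun m =>
    (hcc m).mul (hgc m)
  rw [intervalIntegral.integral_finsetSum fun m _ => (hcg m).intervalIntegrable _ _] at hint
  simp only [hterm, Finset.sum_add_distrib] at hint
  have hzt : (z t).1 n = y n t := rfl
  rw [hzt] at hint
  linarith

lemma sum_ringSpacing (L : ℝ) (x : Fin N → ℝ) : ∑ n, (ringSpacing L x n - L / N) = 0 := by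
  have hN : 0 < N := Nat.pos_of_ne_zero (NeZero.ne N)
  have e : ∑ n : Fin N, (if (n : ℕ) + 1 = N then L else 0) = L := by
    rw [Finset.sum_eq_single (⟨N - 1, by omega⟩ : Fin N)]
    · simp only [Nat.sub_add_cancel hN, if_true]
    · intro b _ hb
      rw [if_neg]
      intro h
      exact hb (Fin.ext (by simp only; omega))
    · simp
  have hN' : (N : ℝ) ≠ 0 := by exact_mod_cast hN.ne'
  simp only [ringSpacing, Finset.sum_sub_distrib, Finset.sum_add_distrib, e, sum_shift_eq]
  simp
  field_simp
  simp

end Path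

/-! ### Transients do not affect asymptotic covariances. -/

section Covariance

lemma covariance_congr_ae {Ω : Type*} [MeasurableSpace Ω] {P : Measure Ω} {U U' V V' : Ω → ℝ}
    (hU : U =ᵐ[P] U') (hV : V =ᵐ[P] V') : cov[U, V; P] = cov[U', V'; P] := by
  rw [covariance, covariance, integral_congr_ae hU, integral_congr_ae hV]
  refine integral_congr_ae ?_
  filter_upwards [hU, hV] with ω h1 h2
  rw [h1, h2]

variable {Ω : Type*} [MeasurableSpace Ω] {P : Measure Ω} [IsProbabilityMeasure P]

/-- Both `Var (U + V)` and `Var (U - V)` are nonnegative. -/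
lemma abs_covariance_le_variance_add {U V : Ω → ℝ} (hU : MemLp U 2 P) (hV : MemLp V 2 P) :
    |cov[U, V; P]| ≤ (Var[U; P] + Var[V; P]) / 2 := by
  have h1 := variance_nonneg (U + V) P
  have h2 := variance_nonneg (U - V) P
  rw [variance_add hU hV] at h1
  rw [variance_sub hU hV] at h2
  rw [abs_le]
  constructor <;> linarith

/-- Covariances with a linear combination whose coefficients tend to zero tend to zero. -/
lemma tendsto_covariance_sum_left_zero {ι : Type*} [Fintype ι] {U : ι → Ω → ℝ}
    (hU : ∀ i, MemLp (U i) 2 P) {a : ι → ℝ → ℝ} (ha : ∀ i, Tendsto (a i) atTop (𝓝 0))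
    {V : ℝ → Ω → ℝ} (hV : ∀ t, 0 ≤ t → MemLp (V t) 2 P)
    (hb : ∀ i, IsBoundedUnder (· ≤ ·) atTop fun t => ‖cov[U i, V t; P]‖) :
    Tendsto (fun t => cov[fun ω => ∑ i, a i t * U i ω, V t; P]) atTop (𝓝 0) := by
  have h : Tendsto (fun t => ∑ i, a i t * cov[U i, V t; P]) atTop (𝓝 0) := by
    simpa using tendsto_finsetSum Finset.univ fun i _ =>
      (ha i).zero_mul_isBoundedUnder_le (hb i)
  refine h.congr' ?_
  filter_upwards [eventually_ge_atTop 0] with t ht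
  rw [covariance_fun_sum_left (fun i => (hU i).const_mul (a i t)) (hV t ht)]
  exact Finset.sum_congr rfl fun i _ => (covariance_const_mul_left _).symm

/-- Adding transient linear combinations of fixed variables does not change an asymptotic
covariance. -/
lemma tendsto_covariance_add_transient {ι : Type*} [Fintype ι] {U : ι → Ω → ℝ}
    (hU : ∀ i, MemLp (U i) 2 P) {a b : ι → ℝ → ℝ} (ha : ∀ i, Tendsto (a i) atTop (𝓝 0))
    (hb : ∀ i, Tendsto (b i) atTop (𝓝 0)) {V V' : ℝ → Ω → ℝ}
    (hV : ∀ t, 0 ≤ t → MemLp (V t) 2 P) (hV' : ∀ t, 0 ≤ t → MemLp (V' t) 2 P)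
    {v v' c : ℝ} (hv : Tendsto (fun t => Var[V t; P]) atTop (𝓝 v))
    (hv' : Tendsto (fun t => Var[V' t; P]) atTop (𝓝 v'))
    (hc : Tendsto (fun t => cov[V t, V' t; P]) atTop (𝓝 c)) :
    Tendsto (fun t => cov[fun ω => (∑ i, a i t * U i ω) + V t ω,
      fun ω => (∑ i, b i t * U i ω) + V' t ω; P]) atTop (𝓝 c) := by
  -- The initial data may be correlated with the Wiener processes. Convergent variances still bound
  -- the cross covariances, and the vanishing coefficients do the rest.
  have hbdd : ∀ {V : ℝ → Ω → ℝ} {v : ℝ}, (∀ t, 0 ≤ t → MemLp (V t) 2 P) →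
      Tendsto (fun t => Var[V t; P]) atTop (𝓝 v) →
      ∀ i, IsBoundedUnder (· ≤ ·) atTop fun t => ‖cov[U i, V t; P]‖ := by
    intro V v hV hv i
    refine ((hv.const_add Var[U i; P]).div_const 2).isBoundedUnder_le.mono_le ?_
    filter_upwards [eventually_ge_atTop 0] with t ht
    exact abs_covariance_le_variance_add (hU i) (hV t ht)
  have hsum : ∀ (a : ι → ℝ → ℝ) t, MemLp (fun ω => ∑ i, a i t * U i ω) 2 P := fun a t =>
    memLp_finsetSum _ fun i _ => (hU i).const_mul (a i t)
  have h1 : Tendsto (fun t => cov[fun ω => ∑ i, a i t * U i ω, fun ω => ∑ i, b i t * U i ω; P])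
      atTop (𝓝 0) := by
    refine tendsto_covariance_sum_left_zero hU ha (fun t _ => hsum b t) fun i => ?_
    have := tendsto_covariance_sum_left_zero hU hb (V := fun _ => U i) (fun _ _ => hU i)
      fun j => isBoundedUnder_const
    simp_rw [covariance_comm (U i)]
    exact this.norm.isBoundedUnder_le
  have h2 := tendsto_covariance_sum_left_zero hU ha hV' (hbdd hV' hv')
  have h3 := tendsto_covariance_sum_left_zero hU hb hV (hbdd hV hv)
  have h := ((h1.add h2).add h3).add hc
  simp only [zero_add] at h
  refine h.congr' ?_
  filter_upwards [eventually_ge_atTop 0] with t ht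
  have e := covariance_add_left (hsum a t) (hV t ht) ((hsum b t).add (hV' t ht))
  rw [covariance_add_right (hsum a t) (hsum b t) (hV' t ht),
    covariance_add_right (hV t ht) (hsum b t) (hV' t ht),
    covariance_comm (V t) (fun ω => ∑ i, b i t * U i ω)] at e
  refine Eq.trans ?_ e.symm
  ring

end Covariance

/-! ### Application to the following model. -/

lemma hasDerivWithinAt_spacingDeviation {N : ℕ} [NeZero N] {Ω : Type*} {lam ell L : ℝ}
    {ξ x : Fin N → ℝ → Ω → ℝ} {ω : Ω}
    (h : ∀ n, ∀ t, 0 ≤ t → HasDerivWithinAt (fun s => x n s ω)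
      (lam * (ringSpacing L (fun m => x m t ω) n - ell) + ξ n t ω) (Ici 0) t)
    (n : Fin N) {t : ℝ} (ht : 0 ≤ t) :
    HasDerivWithinAt (fun s => spacingDeviation L x n s ω)
      (lam * (spacingDeviation L x (n + 1) t ω - spacingDeviation L x n t ω)
        + (ξ (n + 1) t ω - ξ n t ω)) (Ici 0) t := by
  have hd := (((h (n + 1) t ht).sub (h n t ht)).add_const
    (if (n : ℕ) + 1 = N then L else 0)).sub_const (L / N)
  refine hd.congr_deriv ?_
  simp only [spacingDeviation]
  ring

section Model

variable {N : ℕ} [NeZero N] {Ω : Type*} [MeasurableSpace Ω] {P : Measure Ω}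
  {lam ell β σ L : ℝ} {W : Fin N → ℝ≥0 → Ω → ℝ} {ξ x : Fin N → ℝ → Ω → ℝ}

/-- The part of the deviation of particle `n` at time `t` that stems from the Wiener processes. -/
def stochasticDeviation (lam β σ : ℝ) (W : Fin N → ℝ≥0 → Ω → ℝ) (n : Fin N) (t : ℝ) (ω : Ω) : ℝ :=
  ∑ m, σ * pathIntegral (W m) (fun s => noiseKernelDeriv lam β n m (t - s)) t ω

lemma continuous_noiseKernelDeriv_sub (n m : Fin N) (t : ℝ) :
    Continuous fun s => noiseKernelDeriv lam β n m (t - s) :=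
  (continuous_noiseKernelDeriv n m).comp (by fun_prop)

lemma memLp_stochasticDeviation [IsProbabilityMeasure P] (hW : ∀ n, IsBrownianReal (W n) P)
    (n : Fin N) {t : ℝ} (ht : 0 ≤ t) : MemLp (stochasticDeviation lam β σ W n t) 2 P :=
  memLp_finsetSum _ fun m _ =>
    (memLp_pathIntegral (hW m) (continuous_noiseKernelDeriv_sub n m t) ht).const_mul σ

/-- Independence removes the terms with different driving processes; each remaining one is
integrated by parts. -/
lemma covariance_stochasticDeviation [IsProbabilityMeasure P] (hW : ∀ n, IsBrownianReal (W n) P)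
    (hi : iIndepFun (fun n ω t => W n t ω) P) (hβ : β ≠ 0) (n n' : Fin N) {t τ : ℝ} (ht : 0 ≤ t)
    (hτ : 0 ≤ τ) :
    cov[stochasticDeviation lam β σ W n t, stochasticDeviation lam β σ W n' (t + τ); P] =
      σ ^ 2 * ∑ m, ∫ v in (0 : ℝ)..t, noiseKernel lam β n m v * noiseKernel lam β n' m (v + τ) := by
  have hu : 0 ≤ t + τ := by positivity
  have h := covariance_fun_sum_fun_sum (μ := P)
    (X := fun m ω => σ * pathIntegral (W m) (fun s => noiseKernelDeriv lam β n m (t - s)) t ω)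
    (Y := fun m ω =>
      σ * pathIntegral (W m) (fun s => noiseKernelDeriv lam β n' m (t + τ - s)) (t + τ) ω)
    (fun m => (memLp_pathIntegral (hW m) (continuous_noiseKernelDeriv_sub n m t) ht).const_mul σ)
    (fun m => (memLp_pathIntegral (hW m)
      (continuous_noiseKernelDeriv_sub n' m (t + τ)) hu).const_mul σ)
  refine Eq.trans h ?_
  rw [Finset.mul_sum]
  refine Finset.sum_congr rfl fun m _ => ?_
  have e : ∀ m', cov[fun ω => σ * pathIntegral (W m)
        (fun s => noiseKernelDeriv lam β n m (t - s)) t ω, fun ω => σ * pathIntegral (W m')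
        (fun s => noiseKernelDeriv lam β n' m' (t + τ - s)) (t + τ) ω; P] =
      if m = m' then σ ^ 2 * ∫ v in (0 : ℝ)..t,
        noiseKernel lam β n m v * noiseKernel lam β n' m (v + τ) else 0 := by
    intro m'
    rw [covariance_const_mul_left, covariance_const_mul_right]
    have h2 := covariance_pathIntegral hW hi m m' (continuous_noiseKernelDeriv_sub (lam := lam)
      (β := β) n m t) (continuous_noiseKernelDeriv_sub (lam := lam) (β := β) n' m' (t + τ)) ht hu
    have h3 : cov[fun ω => pathIntegral (W m) (fun s => noiseKernelDeriv lam β n m (t - s)) t ω,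
      fun ω => pathIntegral (W m')
        (fun s => noiseKernelDeriv lam β n' m' (t + τ - s)) (t + τ) ω; P] = _ := h2
    rw [h3]
    split_ifs with hm
    · subst hm
      rw [integral_integral_mul_min (fun s => hasDerivAt_noiseKernel hβ n m s)
        (fun s => hasDerivAt_noiseKernel hβ n' m s) (continuous_noiseKernelDeriv n m)
        (continuous_noiseKernelDeriv n' m) (noiseKernel_zero n m) (noiseKernel_zero n' m) ht hτ]
      ring
    · simp
  simp only [e, Finset.sum_ite_eq, Finset.mem_univ, if_true]

lemma tendsto_covariance_stochasticDeviation [IsProbabilityMeasure P]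
    (hW : ∀ n, IsBrownianReal (W n) P) (hi : iIndepFun (fun n ω t => W n t ω) P)
    (hlam : 0 < lam) (hβ : 0 < β) (n j : Fin N) {τ : ℝ} (hτ : 0 ≤ τ) :
    Tendsto (fun t => cov[stochasticDeviation lam β σ W n t,
      stochasticDeviation lam β σ W (n + j) (t + τ); P]) atTop
      (𝓝 (σ ^ 2 * stationaryCovariance N lam β j τ)) := by
  rw [← sum_integral_noiseKernel n j τ]
  have h : Tendsto (fun t => σ ^ 2 * ∑ m : Fin N, ∫ v in (0 : ℝ)..t,
      noiseKernel lam β n m v * noiseKernel lam β (n + j) m (v + τ)) atTop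
      (𝓝 (σ ^ 2 * ∑ m : Fin N, ∫ v in Ioi (0 : ℝ),
        noiseKernel lam β n m v * noiseKernel lam β (n + j) m (v + τ))) :=
    (tendsto_finsetSum _ fun m _ => intervalIntegral_tendsto_integral_Ioi 0
      (integrableOn_noiseKernel_mul hlam hβ n (n + j) m hτ) tendsto_id).const_mul _
  refine h.congr' ?_
  filter_upwards [eventually_ge_atTop 0] with t ht
  exact (covariance_stochasticDeviation hW hi hβ.ne' n (n + j) ht hτ).symm

/-- Coefficients of the initial deviations and initial noises in the deviation of a particle. -/
def transientKernel (lam β : ℝ) (n : Fin N) : Fin N ⊕ Fin N → ℝ → ℝ :=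
  Sum.elim (deviationKernel lam β n) (noiseKernel lam β n)

/-- The initial deviations and initial noises. -/
def initialData (L : ℝ) (ξ x : Fin N → ℝ → Ω → ℝ) : Fin N ⊕ Fin N → Ω → ℝ :=
  Sum.elim (fun m => spacingDeviation L x m 0) (fun m => ξ m 0)

lemma tendsto_transientKernel (hlam : 0 < lam) (hβ : 0 < β) (n : Fin N) (i : Fin N ⊕ Fin N) :
    Tendsto (transientKernel lam β n i) atTop (𝓝 0) := by
  cases i with
  | inl m => exact tendsto_deviationKernel hlam hβ n m
  | inr m => exact tendsto_noiseKernel hlam hβ n m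

lemma IsFollowingModel.spacingDeviation_ae_eq (hM : IsFollowingModel lam ell β σ L P W ξ x)
    (hβ : β ≠ 0) (n : Fin N) {t : ℝ} (ht : 0 ≤ t) :
    (fun ω => (∑ i, transientKernel lam β n i t * initialData L ξ x i ω)
      + stochasticDeviation lam β σ W n t ω) =ᵐ[P] spacingDeviation L x n t := by
  have hWc : ∀ᵐ ω ∂P, ∀ m, Continuous fun s => W m s ω := ae_all_iff.2 fun m => (hM.wiener m).cont
  filter_upwards [hM.noise_continuous, hM.noise_eq, hM.position_deriv, hWc] with ω h1 h2 h3 h4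
  have := deviation_path_eq hβ (y := fun n s => spacingDeviation L x n s ω)
    (ξ := fun n s => ξ n s ω) (w := fun n s => W n s ω) h1 h2
    (fun n t ht => hasDerivWithinAt_spacingDeviation h3 n ht)
    (sum_ringSpacing L fun m => x m 0 ω) h4 n ht
  rw [Fintype.sum_sum_type]
  exact this.symm

end Model

theorem corollary5p2 (N : ℕ) [NeZero N] (hN : 2 ≤ N) (lam β : ℝ) (hlam : 0 < lam) (hβ : 0 < β) :
    ∃ cor : Fin N → ℝ → ℝ,
      ∀ (σ : ℝ), σ ≠ 0 → ∀ (L ell : ℝ), 0 < L → 0 ≤ ell →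
      ∀ (Ω : Type*) [MeasurableSpace Ω] (P : Measure Ω) [IsProbabilityMeasure P]
        (W : Fin N → ℝ≥0 → Ω → ℝ) (ξ x : Fin N → ℝ → Ω → ℝ),
        IsFollowingModel lam ell β σ L P W ξ x →
        (∀ n, MemLp (ξ n 0) 2 P) →
        (∀ n, MemLp (spacingDeviation L x n 0) 2 P) →
        (∀ n t, 0 ≤ t → MemLp (spacingDeviation L x n t) 2 P) ∧
        ∃ c : Fin N → ℝ → ℝ,
          IsAsymptoticCovariance P (spacingDeviation L x) c ∧
          0 < c 0 0 ∧
          ∀ (j : Fin N) (τ : ℝ), 0 ≤ τ → c j τ / c 0 0 = cor j τ := by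
  refine ⟨fun j τ => stationaryCovariance N lam β j τ / stationaryCovariance N lam β 0 0,
    fun σ hσ L ell _ _ Ω _ P _ W ξ x hM hξ0 hy0 => ?_⟩
  have hU : ∀ i, MemLp (initialData L ξ x i) 2 P := by
    rintro (m | m)
    · exact hy0 m
    · exact hξ0 m
  have hσ2 : 0 < σ ^ 2 := by positivity
  refine ⟨fun n t ht => ?_, fun j τ => σ ^ 2 * stationaryCovariance N lam β j τ, ?_,
    mul_pos hσ2 (stationaryCovariance_pos hN hlam hβ),
    fun j τ _ => mul_div_mul_left _ _ hσ2.ne'⟩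
  · refine MemLp.ae_eq (hM.spacingDeviation_ae_eq hβ.ne' n ht) ?_
    exact (memLp_finsetSum _ fun i _ => (hU i).const_mul _).add
      (memLp_stochasticDeviation hM.wiener n ht)
  · intro n j τ hτ
    have hshift : Tendsto (fun t : ℝ => t + τ) atTop atTop :=
      tendsto_atTop_add_const_right _ _ tendsto_id
    -- The variance is the covariance with index offset `0` and lag `0`; its convergence supplies
    -- the bounds for the cross terms.
    have hvar : ∀ n, Tendsto (fun t => Var[stochasticDeviation lam β σ W n t; P]) atTop
        (𝓝 (σ ^ 2 * stationaryCovariance N lam β 0 0)) := by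
      intro n
      refine (tendsto_covariance_stochasticDeviation hM.wiener hM.indep hlam hβ n 0
        le_rfl).congr' ?_
      filter_upwards [eventually_ge_atTop 0] with t ht
      rw [add_zero, add_zero,
        covariance_self (memLp_stochasticDeviation hM.wiener n ht).1.aemeasurable]
    have key := tendsto_covariance_add_transient hU
      (tendsto_transientKernel hlam hβ n)
      (fun i => (tendsto_transientKernel hlam hβ (n + j) i).comp hshift)
      (fun t ht => memLp_stochasticDeviation hM.wiener n ht)
      (fun t ht => memLp_stochasticDeviation (t := t + τ) hM.wiener (n + j) (add_nonneg ht hτ))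
      (hvar n) ((hvar (n + j)).comp hshift)
      (tendsto_covariance_stochasticDeviation hM.wiener hM.indep hlam hβ n j hτ)
    refine key.congr' ?_
    filter_upwards [eventually_ge_atTop 0] with t ht
    exact covariance_congr_ae (hM.spacingDeviation_ae_eq hβ.ne' n ht)
      (hM.spacingDeviation_ae_eq hβ.ne' (n + j) (add_nonneg ht hτ))

end
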